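/- Let $G$ be a metrizable, compactly generated, totally disconnected locally compact group that is metabelian (i.e. its commutator subgroup $[G,G]$ is abelian); compactly generated means that $G$ is generated as a group by some compact subset. A group $\Gamma$ of topological automorphisms of $G$ is called distal if for every $x\in G\setminus\{e\}$ the identity element $e$ is not in the closure of the orbit $\Gamma x=\{\gamma(x) : \gamma\in\Gamma\}$. Then the following conditions are equivalent: (i) $G$ is distal, i.e. the group $\operatorname{Inn}(G)$ of all inner automorphisms of $G$ is distal; (ii) every $g\in G$ is distal, i.e. for every $g\in G$ the group of automorphisms generated by the inner automorphism $x\mapsto gxg^{-1}$ is distal; (iii) $G$ is a SIN group, i.e. the neighbourhoods of $e$ that are invariant under all inner automorphisms of $G$ form a neighbourhood base at $e$. -/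

import Mathlib

open Topology

/-- The group `Aut(G)` of topological automorphisms of `G`, under composition. -/
instance topAutGroup (G : Type*) [Group G] [TopologicalSpace G] : Group (G ≃ₜ* G) where
  mul f g := g.trans f
  one := ContinuousMulEquiv.refl G
  inv f := f.symm
  mul_assoc _ _ _ := rfl
  one_mul _ := rfl
  mul_one _ := rfl
  inv_mul_cancel f := f.self_trans_symm

/-- The homomorphism `G → Aut(G)` that sends `g` to the inner automorphism `x ↦ g * x * g⁻¹`. -/
def topConj (G : Type*) [Group G] [TopologicalSpace G] [IsTopologicalGroup G] :
    G →* (G ≃ₜ* G) where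
  toFun g :=
    { MulAut.conj g with
      continuous_toFun := by
        change Continuous fun x : G => g * x * g⁻¹
        fun_prop
      continuous_invFun := by
        change Continuous fun x : G => g⁻¹ * x * g
        fun_prop }
  map_one' := by
    ext x
    change 1 * x * 1⁻¹ = x
    group
  map_mul' g h := by
    ext x
    change g * h * x * (g * h)⁻¹ = g * (h * x * h⁻¹) * g⁻¹
    group

/-- The group `Inn(G)` of inner automorphisms. -/
def topInn (G : Type*) [Group G] [TopologicalSpace G] [IsTopologicalGroup G] :
    Subgroup (G ≃ₜ* G) :=
  (topConj G).range

/-- A group `Γ` of automorphisms is distal if, for every `x ≠ 1`, the identity element is not in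
the closure of the orbit `Γ x`. -/
def IsDistalAut {G : Type*} [Group G] [TopologicalSpace G] (Γ : Subgroup (G ≃ₜ* G)) : Prop :=
  ∀ x : G, x ≠ 1 → (1 : G) ∉ closure {y : G | ∃ γ ∈ Γ, γ x = y}

/-- A group `Γ` of automorphisms is equicontinuous (at `1`) if the `Γ`-invariant neighbourhoods
of `1` form a neighbourhood base at `1`. -/
def IsEquicontinuousAut {G : Type*} [Group G] [TopologicalSpace G]
    (Γ : Subgroup (G ≃ₜ* G)) : Prop :=
  ∀ U ∈ 𝓝 (1 : G), ∃ V ∈ 𝓝 (1 : G), V ⊆ U ∧ ∀ γ ∈ Γ, (fun x : G => γ x) '' V = V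

/-- An element `g` is distal if the group generated by `x ↦ g * x * g⁻¹` is distal. -/
def IsDistalElement {G : Type*} [Group G] [TopologicalSpace G] [IsTopologicalGroup G]
    (g : G) : Prop :=
  IsDistalAut (Subgroup.zpowers (topConj G g))

/-- `G` is distal if `Inn(G)` is distal. -/
def IsDistalGroup (G : Type*) [Group G] [TopologicalSpace G] [IsTopologicalGroup G] : Prop :=
  IsDistalAut (topInn G)

/-- `G` is a SIN group if `Inn(G)` is equicontinuous. -/
def IsSINGroup (G : Type*) [Group G] [TopologicalSpace G] [IsTopologicalGroup G] : Prop :=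
  IsEquicontinuousAut (topInn G)

/-- `G` is compactly generated (as a group): some compact subset generates `G` algebraically. -/
def IsCompactlyGeneratedGroup (G : Type*) [Group G] [TopologicalSpace G] : Prop :=
  ∃ K : Set G, IsCompact K ∧ Subgroup.closure K = ⊤

/-- `G` is metabelian: the commutator subgroup `[G, G]` is abelian. -/
def IsMetabelianGroup (G : Type*) [Group G] : Prop :=
  ∀ x ∈ commutator G, ∀ y ∈ commutator G, x * y = y * x

/-! Only passing from distal elements to SIN has depth. Ellis' idempotent argument turns distality
of `g` into recurrence: a point whose backward orbit stays in a compact open subgroup never leaves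
it, so by compactness conjugation by `g` is equicontinuous
(`IsDistalElement.eventually_conj_zpow_mem`). For compact generation by `K`, `V ⊓ [G, G]` is
normalized by `V` and by the abelian group `[G, G]`; intersecting its conjugates under powers of
finitely many `g`, chosen so that their cosets `gV` cover `K`, yields a normal `B`, still relatively
open in `[G, G]`. Elements `x` near `1` then satisfy `⁅g, x⁆ ∈ B` for all `g`, which gives invariant
neighbourhoods. -/

/-- Totally disconnected locally compact groups have arbitrarily small compact open subgroups. -/
theorem exists_isOpen_isCompact_subgroup {G : Type*} [Group G] [TopologicalSpace G]
    [IsTopologicalGroup G] [T2Space G] [LocallyCompactSpace G] [TotallyDisconnectedSpace G]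
    {U : Set G} (hU : U ∈ 𝓝 (1 : G)) :
    ∃ V : Subgroup G, IsOpen (V : Set G) ∧ IsCompact (V : Set G) ∧ (V : Set G) ⊆ U := by
  obtain ⟨K, hK1, hKU, hK⟩ := local_compact_nhds hU
  obtain ⟨W, hW, h1W, hWK⟩ :=
    (loc_compact_Haus_tot_disc_of_zero_dim (H := G)).mem_nhds_iff.1 hK1
  have hWc : IsCompact W := hK.of_isClosed_subset hW.isClosed hWK
  have hev : ∀ᶠ g in 𝓝 (1 : G), ∀ w ∈ W, g * w ∈ W := by
    refine hWc.eventually_forall_of_forall_eventually (P := fun g w => g * w ∈ W) fun w hw => ?_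
    have hc : ContinuousAt (fun z : G × G => z.1 * z.2) (1, w) := by fun_prop
    exact hc (hW.isOpen.mem_nhds (by simpa using hw))
  have hev' : ∀ᶠ g in 𝓝 (1 : G), ∀ w ∈ W, g⁻¹ * w ∈ W := by
    have hc : Filter.Tendsto (fun g : G => g⁻¹) (𝓝 1) (𝓝 1) := by
      simpa using (continuous_inv (G := G)).tendsto 1
    exact hc.eventually hev
  let V : Subgroup G :=
    { carrier := {g | (∀ w ∈ W, g * w ∈ W) ∧ ∀ w ∈ W, g⁻¹ * w ∈ W}
      one_mem' := by simp
      mul_mem' := by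
        rintro a b ⟨ha, ha'⟩ ⟨hb, hb'⟩
        refine ⟨fun w hw => ?_, fun w hw => ?_⟩
        · rw [mul_assoc]; exact ha _ (hb _ hw)
        · rw [mul_inv_rev, mul_assoc]; exact hb' _ (ha' _ hw)
      inv_mem' := by
        rintro a ⟨ha, ha'⟩
        exact ⟨ha', by simpa using ha⟩ }
  have hVo : IsOpen (V : Set G) :=
    V.isOpen_of_mem_nhds (g := 1) (Filter.inter_mem hev hev')
  have hVW : (V : Set G) ⊆ W := fun g hg => by simpa using hg.1 1 h1W
  exact ⟨V, hVo, hWc.of_isClosed_subset (V.isClosed_of_isOpen hVo) hVW,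
    hVW.trans (hWK.trans hKU)⟩

/-! ### Dynamics of a single distal element -/

/-- If no two distinct points of a compact Hausdorff space are forward proximal under a continuous
map, then every point is recurrent. -/
theorem mem_closure_iterates_of_forall_proximal_eq {X : Type*} [TopologicalSpace X]
    [CompactSpace X] [T2Space X] {f : X → X} (hf : Continuous f)
    (h : ∀ x y z, (z, z) ∈ closure (Set.range fun n : ℕ => (f^[n] x, f^[n] y)) → x = y) (x : X) :
    x ∈ closure (Set.range fun n : ℕ => f^[n + 1] x) := by
  let _ : Semigroup (X → X) :=
    { mul := fun a b => a ∘ b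
      mul_assoc := fun _ _ _ => rfl }
  have hmul : ∀ a b : X → X, a * b = a ∘ b := fun _ _ => rfl
  have hright : ∀ r : X → X, Continuous fun a : X → X => a * r := fun r =>
    continuous_pi fun y => continuous_apply (r y)
  -- The shift `n + 1` excludes the identity map, whose presence would make recurrence vacuous.
  set S : Set (X → X) := closure (Set.range fun n : ℕ => f^[n + 1]) with hS
  have hleft : ∀ n : ℕ, ∀ b ∈ S, f^[n + 1] ∘ b ∈ S := by
    intro n b hb
    have hc : Continuous fun b : X → X => f^[n + 1] ∘ b :=
      continuous_pi fun y => (hf.iterate _).comp (continuous_apply y)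
    refine map_mem_closure hc hb ?_
    rintro _ ⟨m, rfl⟩
    refine ⟨n + m + 1, ?_⟩
    change f^[n + m + 1 + 1] = f^[n + 1] ∘ f^[m + 1]
    rw [← Function.iterate_add]
    congr 1
    omega
  obtain ⟨u, huS, hu⟩ := exists_idempotent_in_compact_subsemigroup hright S
    ⟨f^[0 + 1], subset_closure ⟨0, rfl⟩⟩ isClosed_closure.isCompact (by
      intro a ha b hb
      have := map_mem_closure (hright b) ha (t := S) (by
        rintro _ ⟨n, rfl⟩
        exact hleft n b hb)
      rwa [hS, closure_closure] at this)
  -- An idempotent `u` sends `x` and `u x` to the same point, so they are proximal.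
  have hux : x = u x := by
    refine h x (u x) (u x) ?_
    have hc : Continuous fun a : X → X => (a x, a (u x)) :=
      (continuous_apply x).prodMk (continuous_apply (u x))
    have := map_mem_closure hc huS (t := Set.range fun n : ℕ => (f^[n] x, f^[n] (u x))) (by
      rintro _ ⟨n, rfl⟩
      exact ⟨n + 1, rfl⟩)
    have huu : u (u x) = u x := congrFun hu x
    simpa only [huu] using this
  have := map_mem_closure (continuous_apply x) huS
    (t := Set.range fun n : ℕ => f^[n + 1] x) (by
      rintro _ ⟨n, rfl⟩
      exact ⟨n, rfl⟩)
  simpa only [← hux] using this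

theorem IsDistalElement.eq_one {G : Type*} [Group G] [TopologicalSpace G] [IsTopologicalGroup G]
    {g x : G} (hg : IsDistalElement g)
    (hx : (1 : G) ∈ closure (Set.range fun n : ℤ => g ^ n * x * (g ^ n)⁻¹)) : x = 1 := by
  by_contra hne
  refine hg x hne (closure_mono ?_ hx)
  rintro _ ⟨n, rfl⟩
  refine ⟨topConj G g ^ n, ⟨n, rfl⟩, ?_⟩
  rw [← map_zpow]
  rfl

theorem IsDistalElement.inv {G : Type*} [Group G] [TopologicalSpace G] [IsTopologicalGroup G]
    {g : G} (hg : IsDistalElement g) : IsDistalElement g⁻¹ := by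
  unfold IsDistalElement at *
  rwa [map_inv, Subgroup.zpowers_inv]

/-- For a distal element `g`, a point whose backward orbit under conjugation by `g` stays in a
compact subgroup `V` does not leave `V` at the next forward step. -/
theorem IsDistalElement.conj_mem {G : Type*} [Group G] [TopologicalSpace G]
    [IsTopologicalGroup G] [T2Space G] {g : G} (hg : IsDistalElement g) {V : Subgroup G}
    (hV : IsCompact (V : Set G)) {y : G} (hy : ∀ n : ℕ, (g ^ n)⁻¹ * y * g ^ n ∈ V) :
    g * y * g⁻¹ ∈ V := by
  let P : Set G := {z | ∀ n : ℕ, (g ^ n)⁻¹ * z * g ^ n ∈ V}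
  have hPc : IsClosed P := by
    simp only [P, Set.ofPred_forall]
    exact isClosed_iInter fun n => hV.isClosed.preimage (by fun_prop)
  have hPV : P ⊆ V := fun z hz => by simpa using hz 0
  have : CompactSpace P := isCompact_iff_compactSpace.1 (hV.of_isClosed_subset hPc hPV)
  let f : P → P := fun z => ⟨g⁻¹ * z * g, fun n => by
    have := z.2 (n + 1)
    rw [pow_succ'] at this
    simpa [mul_assoc] using this⟩
  have hf : Continuous f := by
    refine Continuous.subtype_mk ?_ _
    fun_prop
  have hiter : ∀ (n : ℕ) (z : P), ((f^[n] z : P) : G) = (g ^ n)⁻¹ * z * g ^ n := by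
    intro n
    induction n with
    | zero => intro z; simp
    | succ n ih =>
      intro z
      rw [Function.iterate_succ_apply, ih, pow_succ']
      simp [f, mul_assoc]
  have hrec := mem_closure_iterates_of_forall_proximal_eq hf (fun a b c hc => by
    have hcont : Continuous fun p : P × P => (p.1 : G)⁻¹ * p.2 := by fun_prop
    have h1 := map_mem_closure hcont hc
      (t := Set.range fun n : ℤ => g ^ n * ((a : G)⁻¹ * b) * (g ^ n)⁻¹) (by
        rintro _ ⟨n, rfl⟩
        refine ⟨-n, ?_⟩
        simp only [hiter, zpow_neg, zpow_natCast]
        group)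
    rw [inv_mul_cancel] at h1
    exact Subtype.ext (inv_mul_eq_one.1 (hg.eq_one h1))) ⟨y, hy⟩
  -- `g * y * g⁻¹` is a limit of points `g * f^[n + 1] y * g⁻¹ = f^[n] y`, all in the closed set
  -- `V`.
  have hcont : Continuous fun z : P => g * (z : G) * g⁻¹ := by fun_prop
  have := map_mem_closure hcont hrec (t := (V : Set G)) (by
    rintro _ ⟨n, rfl⟩
    have := hy n
    simp only [hiter, SetLike.mem_coe]
    convert this using 1
    rw [pow_succ]
    group)
  rwa [hV.isClosed.closure_eq] at this

/-- Points of `V` about to leave `V` form a compact set `E` that misses `⋂ C n`, hence misses some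
`C n`; that `C n` is a neighbourhood of `1` mapped into itself. -/
theorem IsDistalElement.eventually_conj_pow_mem {G : Type*} [Group G] [TopologicalSpace G]
    [IsTopologicalGroup G] [T2Space G] {g : G} (hg : IsDistalElement g) {V : Subgroup G}
    (hVo : IsOpen (V : Set G)) (hVc : IsCompact (V : Set G)) :
    ∀ᶠ x in 𝓝 (1 : G), ∀ n : ℕ, g ^ n * x * (g ^ n)⁻¹ ∈ V := by
  let C : ℕ → Set G := fun n => {x | ∀ k ≤ n, (g ^ k)⁻¹ * x * g ^ k ∈ V}
  have hCc : ∀ n, IsClosed (C n) := fun n => by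
    simp only [C, Set.ofPred_forall]
    exact isClosed_iInter fun k => isClosed_iInter fun _ => hVc.isClosed.preimage (by fun_prop)
  have hCo : ∀ n, C n ∈ 𝓝 (1 : G) := fun n => by
    refine (Filter.eventually_all_finite (Set.finite_Iic n)).2 fun k _ => ?_
    have hc : ContinuousAt (fun x : G => (g ^ k)⁻¹ * x * g ^ k) 1 := by fun_prop
    exact hc (hVo.mem_nhds (by simp))
  let E : Set G := (V : Set G) ∩ {x | g * x * g⁻¹ ∈ V}ᶜ
  have hE : IsCompact E := hVc.inter_right
    (hVo.preimage (f := fun x => g * x * g⁻¹) (by fun_prop)).isClosed_compl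
  obtain ⟨n, hn⟩ := hE.elim_directed_family_closed C hCc (by
      refine Set.eq_empty_iff_forall_notMem.2 ?_
      rintro y ⟨⟨-, hy⟩, hyC⟩
      exact hy (hg.conj_mem hVc fun n => Set.mem_iInter.1 hyC n n le_rfl))
    (directed_of_isDirected_le fun i j hij x hx k hk => hx k (hk.trans hij))
  have hstep : ∀ x ∈ C n, g * x * g⁻¹ ∈ C n := by
    intro x hx k hk
    cases k with
    | zero =>
      by_contra hgx
      have hxE : x ∈ E ∩ C n := ⟨⟨by simpa using hx 0 (Nat.zero_le _), by simpa using hgx⟩, hx⟩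
      simp [hn] at hxE
    | succ k =>
      convert hx k (by omega) using 1
      rw [pow_succ']
      group
  filter_upwards [hCo n] with x hx k
  have : ∀ k : ℕ, g ^ k * x * (g ^ k)⁻¹ ∈ C n := by
    intro k
    induction k with
    | zero => simpa using hx
    | succ k ih =>
      convert hstep _ ih using 1
      rw [pow_succ']
      group
  simpa using this k 0 (Nat.zero_le _)

theorem IsDistalElement.eventually_conj_zpow_mem {G : Type*} [Group G] [TopologicalSpace G]
    [IsTopologicalGroup G] [T2Space G] {g : G} (hg : IsDistalElement g) {V : Subgroup G}
    (hVo : IsOpen (V : Set G)) (hVc : IsCompact (V : Set G)) :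
    ∀ᶠ x in 𝓝 (1 : G), ∀ n : ℤ, g ^ n * x * (g ^ n)⁻¹ ∈ V := by
  filter_upwards [hg.eventually_conj_pow_mem hVo hVc, hg.inv.eventually_conj_pow_mem hVo hVc]
    with x h1 h2 n
  obtain ⟨k, rfl | rfl⟩ := n.eq_nat_or_neg
  · simpa using h1 k
  · simpa using h2 k

/-! ### Normal subgroups inside the commutator subgroup -/

open scoped commutatorElement

/-- A subgroup that contains a relative neighbourhood of `1` in `[G, G]` and is normalized by
`[G, G]` can be shrunk so that in addition it is normalized by finitely many given elements, if all
elements of `G` are distal. -/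
theorem exists_le_normalizer_of_finite {G : Type*} [Group G] [TopologicalSpace G]
    [IsTopologicalGroup G] [T2Space G] [LocallyCompactSpace G] [TotallyDisconnectedSpace G]
    (hd : ∀ g : G, IsDistalElement g) {W : Subgroup G}
    (hWn : commutator G ≤ Subgroup.normalizer (W : Set G))
    (hW : ∀ᶠ x in 𝓝 (1 : G), x ∈ commutator G → x ∈ W) (F : Finset G) :
    ∃ B ≤ W, Subgroup.normalizer (W : Set G) ≤ Subgroup.normalizer (B : Set G) ∧
      (F : Set G) ⊆ Subgroup.normalizer (B : Set G) ∧
      ∀ᶠ x in 𝓝 (1 : G), x ∈ commutator G → x ∈ B := by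
  classical
  induction F using Finset.induction_on with
  | empty => exact ⟨W, le_rfl, le_rfl, by simp, hW⟩
  | insert g F _ ih =>
    obtain ⟨B, hBW, hBn, hFB, hB⟩ := ih
    let D : Subgroup G := ⨅ n : ℤ, B.comap (MulAut.conj (g ^ n)).toMonoidHom
    have hD : ∀ x, x ∈ D ↔ ∀ n : ℤ, g ^ n * x * (g ^ n)⁻¹ ∈ B := fun x => by
      simp [D, Subgroup.mem_iInf, ← MulAut.conj_apply]
    have hBD : Subgroup.normalizer (B : Set G) ≤ Subgroup.normalizer (D : Set G) := by
      intro h hh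
      rw [Subgroup.mem_normalizer_iff]
      intro x
      rw [hD, hD]
      refine forall_congr' fun n => ?_
      -- Conjugating `h` changes it only by a commutator, and `[G, G]` already normalizes `B`.
      have hc : g ^ n * h * (g ^ n)⁻¹ ∈ Subgroup.normalizer (B : Set G) := by
        have h1 : ⁅g ^ n, h⁆ ∈ Subgroup.normalizer (B : Set G) :=
          hBn (hWn (Subgroup.commutator_mem_commutator (Subgroup.mem_top _) (Subgroup.mem_top _)))
        have h2 := mul_mem h1 hh
        rwa [commutatorElement_def, inv_mul_cancel_right] at h2
      rw [Subgroup.mem_normalizer_iff] at hc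
      have := hc (g ^ n * x * (g ^ n)⁻¹)
      rw [this]
      group
    have hgD : g ∈ Subgroup.normalizer (D : Set G) := by
      rw [Subgroup.mem_normalizer_iff]
      intro x
      rw [hD, hD]
      refine (Equiv.forall_congr (Equiv.addRight (1 : ℤ)) fun n => ?_).symm
      simp [zpow_add, mul_assoc]
    refine ⟨D, ?_, hBn.trans hBD, ?_, ?_⟩
    · intro x hx
      exact hBW (by simpa using (hD x).1 hx 0)
    · rw [Finset.coe_insert, Set.insert_subset_iff]
      exact ⟨hgD, hFB.trans hBD⟩
    · obtain ⟨V, hVo, hVc, hVB⟩ := exists_isOpen_isCompact_subgroup hB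
      filter_upwards [(hd g).eventually_conj_zpow_mem hVo hVc] with x hx hxA
      exact (hD x).2 fun n => hVB (hx n) (Subgroup.Normal.conj_mem inferInstance x hxA _)

/-- If all elements of a compactly generated metabelian totally disconnected locally compact group
are distal, then `[G, G]` has arbitrarily small relatively open subgroups that are normal in `G`. -/
theorem exists_normal_subgroup_le_commutator {G : Type*} [Group G] [TopologicalSpace G]
    [IsTopologicalGroup G] [T2Space G] [LocallyCompactSpace G] [TotallyDisconnectedSpace G]
    (hcg : IsCompactlyGeneratedGroup G) (hmet : IsMetabelianGroup G)
    (hd : ∀ g : G, IsDistalElement g) {V : Subgroup G} (hV : IsOpen (V : Set G)) :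
    ∃ B ≤ V, B.Normal ∧ ∀ᶠ x in 𝓝 (1 : G), x ∈ commutator G → x ∈ B := by
  obtain ⟨K, hK, hKG⟩ := hcg
  have hVA : V ≤ Subgroup.normalizer ((V ⊓ commutator G : Subgroup G) : Set G) := by
    intro v hv
    rw [Subgroup.mem_normalizer_iff]
    intro x
    simp only [Subgroup.mem_inf]
    have hN : (commutator G).Normal := inferInstance
    rw [← hN.mem_comm_iff (a := v⁻¹), ← mul_assoc, inv_mul_cancel, one_mul,
      V.mul_mem_cancel_right (V.inv_mem hv), V.mul_mem_cancel_left hv]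
  have hA : commutator G ≤ Subgroup.normalizer ((V ⊓ commutator G : Subgroup G) : Set G) := by
    intro a ha
    rw [Subgroup.mem_normalizer_iff]
    intro x
    simp only [Subgroup.mem_inf]
    have key : ∀ y ∈ commutator G, a * y * a⁻¹ = y := fun y hy => by
      rw [hmet a ha y hy, mul_inv_cancel_right]
    constructor
    · rintro ⟨hx, hxA⟩
      rw [key x hxA]
      exact ⟨hx, hxA⟩
    · rintro ⟨hx, hxA⟩
      have hxA' : x ∈ commutator G := by
        have := mul_mem (mul_mem (inv_mem ha) hxA) ha
        simpa [mul_assoc] using this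
      rw [key x hxA'] at hx
      exact ⟨hx, hxA'⟩
  -- Finitely many cosets `kV` cover `K`, and `V` normalizes `V ⊓ [G, G]`, so only the
  -- representatives in `F` need treatment.
  obtain ⟨F, -, hF⟩ := hK.elim_nhds_subcover (fun k => (fun x => k⁻¹ * x) ⁻¹' (V : Set G))
    fun k _ => (hV.preimage (by fun_prop)).mem_nhds (by simp)
  obtain ⟨B, hBV, hBn, hFB, hB⟩ := exists_le_normalizer_of_finite hd hA
    (by filter_upwards [hV.mem_nhds V.one_mem] with x hx hxA using ⟨hx, hxA⟩) F
  refine ⟨B, hBV.trans inf_le_left, ?_, hB⟩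
  rw [← Subgroup.normalizer_eq_top_iff, eq_top_iff, ← hKG, Subgroup.closure_le]
  intro x hx
  obtain ⟨k, hk, hkx⟩ := Set.mem_iUnion₂.1 (hF hx)
  have := mul_mem (hFB hk) (hBn (hVA hkx))
  simpa using this

/-- If `[G, G]` has arbitrarily small relatively open subgroups that are normal in `G`, then a
compactly generated totally disconnected locally compact group `G` is a SIN group. -/
theorem isSINGroup_of_forall_exists_normal {G : Type*} [Group G] [TopologicalSpace G]
    [IsTopologicalGroup G] [T2Space G] [LocallyCompactSpace G] [TotallyDisconnectedSpace G]
    (hcg : IsCompactlyGeneratedGroup G)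
    (h : ∀ V : Subgroup G, IsOpen (V : Set G) →
      ∃ B ≤ V, B.Normal ∧ ∀ᶠ x in 𝓝 (1 : G), x ∈ commutator G → x ∈ B) :
    IsSINGroup G := by
  intro U hU
  obtain ⟨V, hVo, -, hVU⟩ := exists_isOpen_isCompact_subgroup hU
  obtain ⟨B, hBV, hBn, hB⟩ := h V hVo
  obtain ⟨K, hK, hKG⟩ := hcg
  have hcomm : ∀ g x : G, ⁅g, x⁆ ∈ commutator G := fun g x =>
    Subgroup.commutator_mem_commutator (Subgroup.mem_top _) (Subgroup.mem_top _)
  let N : Set G := {x | x ∈ V ∧ ∀ g : G, ⁅g, x⁆ ∈ B}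
  have hN : N ∈ 𝓝 (1 : G) := by
    have hev : ∀ᶠ x in 𝓝 (1 : G), ∀ g ∈ K, ⁅g, x⁆ ∈ B := by
      refine hK.eventually_forall_of_forall_eventually (P := fun x g => ⁅g, x⁆ ∈ B) fun g _ => ?_
      have hc : Filter.Tendsto (fun z : G × G => ⁅z.2, z.1⁆) (𝓝 (1, g)) (𝓝 1) := by
        have : Continuous fun z : G × G => ⁅z.2, z.1⁆ := by
          simp only [commutatorElement_def]
          fun_prop
        simpa using this.tendsto (1, g)
      filter_upwards [hc.eventually hB] with z hz using hz (hcomm _ _)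
    filter_upwards [hVo.mem_nhds V.one_mem, hev] with x hxV hx
    refine ⟨hxV, fun g => ?_⟩
    have hg : g ∈ Subgroup.closure K := hKG ▸ Subgroup.mem_top g
    -- Normality of `B` carries the bound from `K` to words: `⁅a * b, x⁆ = (a * ⁅b, x⁆ * a⁻¹) * ⁅a,
    -- x⁆`.
    induction hg using Subgroup.closure_induction with
    | mem g hg => exact hx g hg
    | one => simp
    | mul a b _ _ ha hb =>
      have := mul_mem (hBn.conj_mem _ hb a) ha
      convert this using 1
      simp only [commutatorElement_def]
      group
    | inv a _ ha =>
      have := hBn.conj_mem _ (inv_mem ha) a⁻¹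
      convert this using 1
      simp only [commutatorElement_def]
      group
  -- Here `g * x * g⁻¹ = ⁅g, x⁆ * x` lies in `V` because `B ≤ V`, and `⁅k, g * x * g⁻¹⁆` is the
  -- `g`-conjugate of `⁅g⁻¹ * k * g, x⁆`.
  have hconj : ∀ g : G, ∀ x ∈ N, g * x * g⁻¹ ∈ N := by
    rintro g x ⟨hxV, hx⟩
    refine ⟨?_, fun k => ?_⟩
    · have := mul_mem (hBV (hx g)) hxV
      rwa [commutatorElement_def, inv_mul_cancel_right] at this
    · have := hBn.conj_mem _ (hx (g⁻¹ * k * g)) g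
      convert this using 1
      simp only [commutatorElement_def]
      group
  refine ⟨N, hN, fun x hx => hVU hx.1, ?_⟩
  rintro _ ⟨g, rfl⟩
  refine Set.Subset.antisymm ?_ fun x hx => ?_
  · rintro _ ⟨x, hx, rfl⟩
    exact hconj g x hx
  · refine ⟨g⁻¹ * x * g, by simpa using hconj g⁻¹ x hx, ?_⟩
    change g * (g⁻¹ * x * g) * g⁻¹ = x
    group

theorem IsEquicontinuousAut.isDistalAut {G : Type*} [Group G] [TopologicalSpace G] [T1Space G]
    {Γ : Subgroup (G ≃ₜ* G)} (h : IsEquicontinuousAut Γ) : IsDistalAut Γ := by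
  intro x hx hcl
  obtain ⟨V, hV, hVx, hVΓ⟩ := h {x}ᶜ (isOpen_compl_singleton.mem_nhds hx.symm)
  obtain ⟨_, hyV, γ, hγ, rfl⟩ := mem_closure_iff_nhds.1 hcl V hV
  rw [← hVΓ γ hγ] at hyV
  obtain ⟨z, hz, hzx⟩ := hyV
  exact hVx hz (γ.injective hzx)

theorem IsDistalAut.mono {G : Type*} [Group G] [TopologicalSpace G] {Γ Δ : Subgroup (G ≃ₜ* G)}
    (h : IsDistalAut Δ) (hle : Γ ≤ Δ) : IsDistalAut Γ := by
  intro x hx hcl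
  refine h x hx (closure_mono ?_ hcl)
  rintro y ⟨γ, hγ, hy⟩
  exact ⟨γ, hle hγ, hy⟩

theorem theorem2p15 (G : Type*) [Group G] [TopologicalSpace G] [IsTopologicalGroup G]
    [TopologicalSpace.MetrizableSpace G] [LocallyCompactSpace G] [TotallyDisconnectedSpace G]
    (hcg : IsCompactlyGeneratedGroup G) (hmet : IsMetabelianGroup G) :
    List.TFAE [IsDistalGroup G, ∀ g : G, IsDistalElement g, IsSINGroup G] := by
  tfae_have 1 → 2 := fun h g =>
    IsDistalAut.mono h (Subgroup.zpowers_le.2 (MonoidHom.mem_range.2 ⟨g, rfl⟩))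
  tfae_have 2 → 3 := fun h => isSINGroup_of_forall_exists_normal hcg fun V hV =>
    exists_normal_subgroup_le_commutator hcg hmet h hV
  tfae_have 3 → 1 := fun h => IsEquicontinuousAut.isDistalAut h
  tfae_finish
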